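/- Fix $K$ customer classes, server numbers $m=(m_1,\dots,m_K)\in\mathbb Z_+^K$ (layer 1, where $m_k$ servers are dedicated to class $k$) and $n\in\mathbb Z_+$ (layer 2, shared by all classes), arrival rates $\lambda_k\ge 0$ and service rates $\mu_k\ge 0$. Let $$S=\Big\{x=(x_{1,k},x_{2,k})_{k=1}^K\in\mathbb Z_+^K\times\mathbb Z_+^K:\ x_{1,k}\le m_k\ \forall k,\ \sum_{k} x_{2,k}\le n\Big\},\qquad |x|=\sum_{i,k}x_{i,k},$$ and let $e_{i,k}$ be the unit vectors. Put $A_{1,k}=\{x\in S: x_{1,k}<m_k\}$ and $A_{2,k}=\{x\in S: x_{1,k}=m_k,\ \sum_l x_{2,l}<n\}$. Let $X$ (the two-layer loss system with overflow routing) and $X^{\mathrm{mp}}$ (the same system with maximum packing) be continuous-time Markov processes on $S$ with paths in the space $D(\mathbb R_+,S)$ of right-continuous functions with left-hand limits. Both have the upward transitions $x\mapsto x+e_{i,k}$ at rate $\lambda_k 1(x\in A_{i,k})$, $i=1,2$. The downward transitions $x\mapsto x-e_{i,k}$ have rate $\mu_k x_{i,k}$ for $X$, and for $X^{\mathrm{mp}}$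 they have rates $$\phi'_{1,k}(x)=\mu_k x_{1,k}1(x_{2,k}=0),\qquad \phi'_{2,k}(x)=\mu_k x_{1,k}1(x_{2,k}>0)+\mu_k x_{2,k}.$$ For $x,y\in S$ write $x\preceq y$ if $x_{1,k}\le y_{1,k}$ for all $k$ and $|x|\le|y|$; for $f,g\in D(\mathbb R_+,S)$ write $f\preceq g$ if $f(t)\preceq g(t)$ for all $t\ge0$. Theorem. Assume that all service rates $\mu_k$ are equal and that the initial states satisfy $X(0)\preceq X^{\mathrm{mp}}(0)$ almost surely. Then $X\preceq_{\mathrm{st}}X^{\mathrm{mp}}$, that is, $\operatorname{E}\phi(X)\le\operatorname{E}\phi(X^{\mathrm{mp}})$ for all bounded measurable $\phi:D(\mathbb R_+,S)\to\mathbb R$ that are increasing with respect to $\preceq$. In particular, $|X|\le_{\mathrm{st}}|X^{\mathrm{mp}}|$ as processes, that is, $\operatorname{E}\phi(|X|)\le\operatorname{E}\phi(|X^{\mathrm{mp}}|)$ for all bounded measurable $\phi:D(\mathbb R_+,\mathbb R)\to\mathbb R$ that are increasing with respect to the pointwise order on $D(\mathbb R_+,\mathbb R)$. -/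

import Mathlib

open MeasureTheory Filter Topology
open scoped NNReal

namespace LossSystem

/-! ### Path space, Markov jump processes and stochastic orders -/

/-- The space `D(ℝ₊, E)` of right-continuous functions `ℝ₊ → E` with left-hand limits. -/
def SkorokhodSpace (E : Type*) [TopologicalSpace E] : Type _ :=
  {f : ℝ≥0 → E // ∀ t, ContinuousWithinAt f (Set.Ici t) t ∧ ∃ l, Tendsto f (𝓝[<] t) (𝓝 l)}

instance {E : Type*} [TopologicalSpace E] : CoeFun (SkorokhodSpace E) (fun _ => ℝ≥0 → E) :=
  ⟨fun f => f.1⟩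

/-- The σ-algebra on `D(ℝ₊, E)` generated by the evaluations `f ↦ f t` (for separable metrizable `E`
it is the Borel σ-algebra of the Skorokhod topology). -/
instance {E : Type*} [TopologicalSpace E] [MeasurableSpace E] :
    MeasurableSpace (SkorokhodSpace E) :=
  ⨆ t : ℝ≥0, MeasurableSpace.comap (fun f : SkorokhodSpace E => f t) inferInstance

/-- Post-composition of a path with a continuous function. -/
def SkorokhodSpace.map {E F : Type*} [TopologicalSpace E] [TopologicalSpace F] (g : E → F)
    (hg : Continuous g) (f : SkorokhodSpace E) : SkorokhodSpace F :=
  ⟨fun t => g (f t), fun t =>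
    ⟨hg.continuousAt.comp_continuousWithinAt (f.2 t).1,
      let ⟨l, hl⟩ := (f.2 t).2
      ⟨g l, (hg.tendsto l).comp hl⟩⟩⟩

/-- `X` is a continuous-time Markov process on the finite set `S` with paths in `D(ℝ₊, S)` and
generator (matrix of transition rates) `Q`: its transition probabilities over a time interval of
length `t` are the entries of `exp (t Q)`, the initial distribution being arbitrary. -/
structure IsMarkovProcess {Ω S : Type*} [MeasurableSpace Ω] [Fintype S] [DecidableEq S]
    [TopologicalSpace S] [MeasurableSpace S] (P : Measure Ω) (Q : Matrix S S ℝ)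
    (X : Ω → SkorokhodSpace S) : Prop where
  measurable : Measurable X
  finiteDimensional : ∀ (N : ℕ) (t : Fin (N + 1) → ℝ≥0) (x : Fin (N + 1) → S), Monotone t →
    P.real {ω | ∀ j, X ω (t j) = x j} =
      P.real {ω | X ω (t 0) = x 0} *
        ∏ j : Fin N, NormedSpace.exp (((t j.succ : ℝ) - (t j.castSucc : ℝ)) • Q)
          (x j.castSucc) (x j.succ)

/-- The stochastic order on random elements of `E` induced by a relation `r` on `E`:
`E φ(X) ≤ E φ(Y)` for all bounded measurable `φ : E → ℝ` that are increasing with respect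
to `r`. -/
def StochLE {Ω E : Type*} [MeasurableSpace Ω] [MeasurableSpace E] (P : Measure Ω)
    (r : E → E → Prop) (X Y : Ω → E) : Prop :=
  ∀ φ : E → ℝ, Measurable φ → (∃ C, ∀ f, |φ f| ≤ C) → (∀ f g, r f g → φ f ≤ φ g) →
    ∫ ω, φ (X ω) ∂P ≤ ∫ ω, φ (Y ω) ∂P

/-- The pointwise extension to `D(ℝ₊, E)` of a relation on `E`: `f t` is related to `g t` for
all `t`. -/
def PathRel {E : Type*} [TopologicalSpace E] (r : E → E → Prop) (f g : SkorokhodSpace E) : Prop :=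
  ∀ t, r (f t) (g t)

/-! ### The two-layer loss system -/

section

variable {K : ℕ}

/-- The state space of the system with `m k` layer-1 servers dedicated to class `k` and `n` layer-2
servers. The entry `x 0 k` is the number of class-`k` customers served at layer 1, and `x 1 k` is the
number of class-`k` customers served at layer 2. -/
abbrev State (m : Fin K → ℕ) (n : ℕ) : Type :=
  {x : Fin 2 → Fin K → ℕ // (∀ k, x 0 k ≤ m k) ∧ ∑ k, x 1 k ≤ n}

instance (m : Fin K → ℕ) (n : ℕ) : Finite (State m n) := by
  refine Set.Finite.to_subtype ((Set.finite_Iic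
    (fun (_ : Fin 2) (k : Fin K) => m k + n)).subset ?_)
  rintro x ⟨h1, h2⟩ i k
  have h3 : x 1 k ≤ ∑ l, x 1 l :=
    Finset.single_le_sum (f := fun l => x 1 l) (fun _ _ => Nat.zero_le _) (Finset.mem_univ k)
  have h4 := h1 k
  fin_cases i
  · show x 0 k ≤ m k + n
    omega
  · show x 1 k ≤ m k + n
    omega

noncomputable instance (m : Fin K → ℕ) (n : ℕ) : Fintype (State m n) := Fintype.ofFinite _

variable {m : Fin K → ℕ} {n : ℕ}

/-- The total number of customers `|x|`. -/
def total (x : State m n) : ℕ := ∑ i, ∑ k, x.1 i k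

/-- The preorder `x ⪯ y`: `x_{1,k} ≤ y_{1,k}` for all `k`, and `|x| ≤ |y|`. -/
def Prec (x y : State m n) : Prop :=
  (∀ k, x.1 0 k ≤ y.1 0 k) ∧ total x ≤ total y

/-- The unit vector `e_{i,k}`. -/
def unitVec (i : Fin 2) (k : Fin K) : Fin 2 → Fin K → ℕ := Pi.single i (Pi.single k 1)

/-- The states in which an arriving class-`k` customer is assigned to a layer-1 server
(for `i = 0`), respectively to a layer-2 server (for `i = 1`). -/
def acceptSet (m : Fin K → ℕ) (n : ℕ) : Fin 2 → Fin K → Set (State m n)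
  | 0, k => {x | x.1 0 k < m k}
  | 1, k => {x | x.1 0 k = m k ∧ ∑ l, x.1 1 l < n}

open Classical in
/-- Rate of the upward transition `x ↦ x + e_{i,k}` (both systems). -/
noncomputable def upRate (lam : Fin K → ℝ) (i : Fin 2) (k : Fin K) (x : State m n) : ℝ :=
  if x ∈ acceptSet m n i k then lam k else 0

/-- Rate of the downward transition `x ↦ x - e_{i,k}` in the original system. -/
def downRate (mu : Fin K → ℝ) (i : Fin 2) (k : Fin K) (x : State m n) : ℝ :=
  mu k * x.1 i k

/-- Rate of the downward transition `x ↦ x - e_{i,k}` under maximum packing: a customer leaving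
layer 1 is immediately replaced by a layer-2 customer of the same class, if there is one. -/
def downRateMP (mu : Fin K → ℝ) : Fin 2 → Fin K → State m n → ℝ
  | 0, k, x => if x.1 1 k = 0 then mu k * x.1 0 k else 0
  | 1, k, x => (if 0 < x.1 1 k then mu k * x.1 0 k else 0) + mu k * x.1 1 k

/-- The rate of jumps from `x` to `y` for given rates of the transitions `x ↦ x + e_{i,k}` and
`x ↦ x - e_{i,k}`. -/
noncomputable def jumpRate (up down : Fin 2 → Fin K → State m n → ℝ) (x y : State m n) : ℝ :=
  ∑ i, ∑ k, ((if y.1 = x.1 + unitVec i k then up i k x else 0) +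
    (if x.1 = y.1 + unitVec i k then down i k x else 0))

/-- The generator: jump rates off the diagonal, and rows summing to zero. -/
noncomputable def generator (up down : Fin 2 → Fin K → State m n → ℝ) :
    Matrix (State m n) (State m n) ℝ :=
  fun x y => if x = y then -∑ z ∈ Finset.univ.erase x, jumpRate up down x z
    else jumpRate up down x y

/-- The generator of the two-layer loss system with overflow routing, with arrival rates `lam` and
service rates `mu`. -/
noncomputable def overflowGenerator (m : Fin K → ℕ) (n : ℕ) (lam mu : Fin K → ℝ) :
    Matrix (State m n) (State m n) ℝ :=
  generator (upRate lam) (downRate mu)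

/-- The generator of the system with maximum packing. -/
noncomputable def packingGenerator (m : Fin K → ℕ) (n : ℕ) (lam mu : Fin K → ℝ) :
    Matrix (State m n) (State m n) ℝ :=
  generator (upRate lam) (downRateMP mu)

/-- The real-valued path `t ↦ |f t|`. -/
def totalPath (f : SkorokhodSpace (State m n)) : SkorokhodSpace ℝ :=
  f.map (fun x => (total x : ℝ)) continuous_of_discreteTopology

end

end LossSystem

/-! Both statements follow from a Markovian coupling: a jump process on the pairs `(x, y)` with
`x ⪯ y` whose coordinates are the overflow system and the maximum packing system.

The coupling uses common arrivals, which preserve `⪯` (`Prec.arrive`). In the larger state, a departure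
empties a layer-1 server only if layer 2 holds no customer of that class. As all service rates agree,
each layer-1 customer of the smaller state `x` can be matched with a layer-1 customer of the same
class of the larger state `y`, and such a pair departs simultaneously. The remaining customers of `y`
are at least as many as the layer-2 customers of `x`, so a departure from layer 2 of `x` can be made to
coincide with the departure of a remaining customer of `y`; these departures never bring a layer-1
coordinate of `y` below that of `x`. This is `coupledGenerator`; its marginals are computed in
`coupledGenerator_mulVec_fst` and `coupledGenerator_mulVec_snd`.

It remains to pass from generators to laws on path space (`stochLE_of_coupling`). Intertwining of the
generators gives intertwining of their exponentials (`exp_mul_of_intertwine`), so the coupled chain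
sampled at the times `j / 2 ^ k` has the sampled systems as its coordinates (`map_chainMeasure`). These
chains define laws of functions from the dyadic times to the finite set of ordered pairs; this
function space is compact, so a weak limit of them exists, and its coordinates have the laws of the two
systems restricted to the dyadic times. A bounded measurable function on `D(ℝ₊, S)` factors through
this restriction by right-continuity (`comap_dyadicRestrict`). The restrictions of paths of `D(ℝ₊, S)`
form a measurable set (`range_dyadicRestrict`, `measurableSet_regularPaths`), so almost surely the two
coordinates of the limit come from paths, and these are ordered at all times. -/

namespace LossSystem

/-! ### Exponentials of finite matrices -/

section MatrixExponential

variable {ι κ : Type*} [Fintype ι] [DecidableEq ι] [Fintype κ] [DecidableEq κ]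

theorem hasSum_matrix_exp (A : Matrix ι ι ℝ) :
    HasSum (fun n : ℕ => (n.factorial⁻¹ : ℝ) • A ^ n) (NormedSpace.exp A) := by
  let _ : NormedRing (Matrix ι ι ℝ) := Matrix.linftyOpNormedRing
  let _ : NormedAlgebra ℝ (Matrix ι ι ℝ) := Matrix.linftyOpNormedAlgebra
  exact NormedSpace.exp_series_hasSum_exp' (𝕂 := ℝ) A

theorem exp_mul_of_intertwine {A : Matrix ι ι ℝ} {B : Matrix κ κ ℝ} {J : Matrix ι κ ℝ}
    (h : A * J = J * B) : NormedSpace.exp A * J = J * NormedSpace.exp B := by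
  have hpow : ∀ n : ℕ, A ^ n * J = J * B ^ n := by
    intro n
    induction n with
    | zero => simp
    | succ n ih => rw [pow_succ, Matrix.mul_assoc, h, ← Matrix.mul_assoc, ih, Matrix.mul_assoc,
        ← pow_succ]
  have h1 := (hasSum_matrix_exp A).map (AddMonoidHom.mk' (fun M : Matrix ι ι ℝ => M * J)
    fun M N => Matrix.add_mul M N J) (by
      show Continuous fun M : Matrix ι ι ℝ => M * J
      fun_prop)
  have h2 := (hasSum_matrix_exp B).map (AddMonoidHom.mk' (fun M : Matrix κ κ ℝ => J * M)
    fun M N => Matrix.mul_add J M N) (by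
      show Continuous fun M : Matrix κ κ ℝ => J * M
      fun_prop)
  refine h1.unique ?_
  have h3 : (fun n : ℕ => ((n.factorial : ℝ)⁻¹ • A ^ n) * J) =
      fun n : ℕ => J * ((n.factorial : ℝ)⁻¹ • B ^ n) := by
    funext n
    rw [Matrix.smul_mul, hpow, Matrix.mul_smul]
  exact (congrArg (fun f => HasSum f (J * NormedSpace.exp B)) h3).mpr h2

theorem exp_apply_nonneg {A : Matrix ι ι ℝ} (h : ∀ i j, 0 ≤ A i j) (i j : ι) :
    0 ≤ NormedSpace.exp A i j := by
  have hpow : ∀ (n : ℕ) i j, 0 ≤ (A ^ n) i j := by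
    intro n
    induction n with
    | zero =>
      intro i j
      rw [pow_zero, Matrix.one_apply]
      split_ifs <;> norm_num
    | succ n ih =>
      intro i j
      rw [pow_succ, Matrix.mul_apply]
      exact Finset.sum_nonneg fun k _ => mul_nonneg (ih i k) (h k j)
  have h1 := Pi.hasSum.1 (Pi.hasSum.1 (hasSum_matrix_exp A) i) j
  exact h1.nonneg fun n => mul_nonneg (by positivity) (hpow n i j)

/-- Adding a large multiple of the identity makes all entries nonnegative, and only multiplies the
exponential by a positive scalar. -/
theorem exp_smul_apply_nonneg {A : Matrix ι ι ℝ} (h : ∀ i j, i ≠ j → 0 ≤ A i j) {t : ℝ}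
    (ht : 0 ≤ t) (i j : ι) : 0 ≤ NormedSpace.exp (t • A) i j := by
  set c : ℝ := ∑ i, |A i i| with hc
  have hsplit : t • A = t • (A + c • (1 : Matrix ι ι ℝ)) + Matrix.diagonal (fun _ => -(t * c)) := by
    ext a b
    by_cases hab : a = b
    · subst hab
      simp
    · simp [hab]
  have hcomm : Commute (t • (A + c • (1 : Matrix ι ι ℝ)))
      (Matrix.diagonal (fun _ => -(t * c))) :=
    (Matrix.scalar_commute _ (fun _ => Commute.all _ _) _).symm
  rw [hsplit, Matrix.exp_add_of_commute _ _ hcomm, Matrix.exp_diagonal, Matrix.mul_diagonal]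
  refine mul_nonneg (exp_apply_nonneg (fun a b => ?_) i j) ?_
  · refine mul_nonneg ht ?_
    by_cases hab : a = b
    · subst hab
      have h1 : |A a a| ≤ c :=
        Finset.single_le_sum (f := fun i => |A i i|) (fun _ _ => abs_nonneg _) (Finset.mem_univ a)
      have h2 := neg_abs_le (A a a)
      simp
      linarith
    · simpa [hab] using h a b hab
  · rw [Pi.coe_exp, ← Real.exp_eq_exp_ℝ]
    exact (Real.exp_pos _).le

end MatrixExponential

/-! ### Finite-dimensional distributions of a lumped Markov chain -/

/-- If the map `p` lumps the transition matrix `M` to `N`, then the total weight of the `M`-paths over a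
given path `x` is the weight of `x` under `N`. -/
theorem sum_fiber_markov {C S : Type*} [Fintype C] [DecidableEq S] (p : C → S)
    (M : C → C → ℝ) (N : S → S → ℝ)
    (h : ∀ c s, ∑ c', (if p c' = s then M c c' else 0) = N (p c) s) (n : ℕ) (ν : C → ℝ)
    (x : Fin (n + 1) → S) :
    ∑ z : Fin (n + 1) → C, (if p ∘ z = x then
        ν (z 0) * ∏ j : Fin n, M (z j.castSucc) (z j.succ) else 0) =
      (∑ c, if p c = x 0 then ν c else 0) * ∏ j : Fin n, N (x j.castSucc) (x j.succ) := by
  induction n generalizing ν with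
  | zero =>
    rw [← (Equiv.funUnique (Fin 1) C).symm.sum_comp]
    simp only [Finset.univ_eq_empty, Finset.prod_empty, mul_one]
    refine Finset.sum_congr rfl fun c _ => ?_
    have : p ∘ (Equiv.funUnique (Fin 1) C).symm c = x ↔ p c = x 0 := by
      rw [funext_iff, Fin.forall_fin_one]
      rfl
    simp only [this]
    rfl
  | succ n ih =>
    rw [← (Fin.consEquiv (fun _ => C)).sum_comp, Fintype.sum_prod_type, Finset.sum_mul]
    refine Finset.sum_congr rfl fun c _ => ?_
    have hc : ∀ z : Fin (n + 1) → C, (p ∘ (Fin.consEquiv (fun _ => C)) (c, z) = x) ↔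
        p c = x 0 ∧ p ∘ z = fun j => x j.succ := by
      intro z
      rw [funext_iff, Fin.forall_fin_succ, funext_iff]
      rfl
    by_cases hx : p c = x 0
    · rw [if_pos hx, Fin.prod_univ_succ]
      have := ih (M c) (fun j => x j.succ)
      rw [h, hx] at this
      rw [show N (x (Fin.castSucc 0)) (x (Fin.succ 0)) *
        ∏ j : Fin n, N (x (j.succ).castSucc) (x (j.succ).succ) = _ from this.symm, Finset.mul_sum]
      refine Finset.sum_congr rfl fun z _ => ?_
      simp only [hc, hx, true_and]
      split_ifs
      · rw [Fin.prod_univ_succ]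
        rfl
      · simp
    · simp [hc, hx]

/-! ### Paths restricted to the dyadic times -/

/-- The dyadic times `j / 2 ^ k`. -/
abbrev DyadicTime : Type :=
  Set.range fun p : ℕ × ℕ => ((p.1 : ℝ≥0) / 2 ^ p.2)

instance : Countable DyadicTime :=
  (Set.countable_range _).to_subtype

theorem exists_dyadicTime_between {a b : ℝ≥0} (h : a < b) : ∃ t : DyadicTime, a < t ∧ t < b := by
  have hab : 0 < b - a := tsub_pos_of_lt h
  obtain ⟨k, hk⟩ := exists_pow_lt_of_lt_one hab (inv_lt_one_of_one_lt₀ (one_lt_two : (1 : ℝ≥0) < 2))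
  have h2 : (0 : ℝ≥0) < 2 ^ k := by positivity
  refine ⟨⟨_, (⌊a * 2 ^ k⌋₊ + 1, k), rfl⟩, ?_, ?_⟩
  · rw [lt_div_iff₀ h2]
    exact_mod_cast Nat.lt_floor_add_one (a * 2 ^ k)
  · rw [div_lt_iff₀ h2]
    have h3 : (⌊a * 2 ^ k⌋₊ : ℝ≥0) ≤ a * 2 ^ k := Nat.floor_le zero_le
    have h4 : a + 2⁻¹ ^ k < b := by
      rw [add_comm]
      exact lt_tsub_iff_right.1 hk
    calc ((⌊a * 2 ^ k⌋₊ + 1 : ℕ) : ℝ≥0) ≤ a * 2 ^ k + 1 := by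
          push_cast
          gcongr
      _ = (a + 2⁻¹ ^ k) * 2 ^ k := by
          rw [add_mul, ← mul_pow, inv_mul_cancel₀ two_ne_zero, one_pow]
      _ < b * 2 ^ k := by gcongr

section Oscillations

variable {S : Type*}

/-- `HasOscillations f M b`: the restricted path `f` has at least `M` successive pairs of dyadic
times up to `b` at which its values differ. -/
def HasOscillations (f : DyadicTime → S) : ℕ → ℝ≥0 → Prop
  | 0, _ => True
  | M + 1, b => ∃ s s' : DyadicTime, s < s' ∧ (s' : ℝ≥0) ≤ b ∧ f s ≠ f s' ∧ HasOscillations f M s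

theorem HasOscillations.mono {f : DyadicTime → S} {M : ℕ} {a b : ℝ≥0}
    (h : HasOscillations f M a) (hab : a ≤ b) : HasOscillations f M b := by
  cases M with
  | zero => trivial
  | succ M =>
    obtain ⟨s, s', h1, h2, h3⟩ := h
    exact ⟨s, s', h1, h2.trans hab, h3⟩

/-- The restricted paths with finitely many oscillations up to any time, which are right-continuous
at the dyadic times. These are the restrictions of paths in `D(ℝ₊, S)` if `S` is discrete, see
`range_dyadicRestrict`. -/
def regularPaths (S : Type*) : Set (DyadicTime → S) :=
  {f | (∀ N : ℕ, ∃ M, ¬ HasOscillations f M N) ∧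
    ∀ t : DyadicTime, ∃ u : DyadicTime, t < u ∧ ∀ s, t ≤ s → s < u → f s = f t}

theorem measurable_apply_eq [MeasurableSpace S] [MeasurableSingletonClass S] (s : DyadicTime)
    (a : S) : Measurable fun f : DyadicTime → S => f s = a := by
  have h : MeasurableSet ((fun f : DyadicTime → S => f s) ⁻¹' {a}) :=
    measurable_pi_apply s (measurableSet_singleton a)
  exact measurableSet_setOfPred.1 h

theorem measurableSet_regularPaths [MeasurableSpace S] [MeasurableSingletonClass S] [Countable S] :
    MeasurableSet (regularPaths S) := by
  have heq : ∀ s t : DyadicTime, Measurable fun f : DyadicTime → S => f s = f t := by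
    intro s t
    have h := Measurable.exists (p := fun (a : S) (f : DyadicTime → S) => f s = a ∧ f t = a)
      fun a => (measurable_apply_eq s a).and (measurable_apply_eq t a)
    convert h using 2 with f
    exact ⟨fun h => ⟨_, h, rfl⟩, fun ⟨_, h1, h2⟩ => h1.trans h2.symm⟩
  have hosc : ∀ (M : ℕ) (b : ℝ≥0), Measurable fun f : DyadicTime → S => HasOscillations f M b := by
    intro M
    induction M with
    | zero => exact fun b => measurable_const
    | succ M ih =>
      intro b
      exact Measurable.exists fun s => Measurable.exists fun s' => measurable_const.and
        (measurable_const.and ((heq s s').not.and (ih s)))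
  refine measurableSet_setOfPred.2 (Measurable.and ?_ ?_)
  · exact Measurable.forall fun N => Measurable.exists fun M => (hosc M N).not
  · exact Measurable.forall fun t => Measurable.exists fun u => measurable_const.and
      (Measurable.forall fun s => Measurable.forall fun _ => Measurable.forall fun _ => heq s t)

theorem exists_const_right {f : DyadicTime → S} (hf : f ∈ regularPaths S) (t : ℝ≥0) :
    ∃ l, ∃ u > t, ∀ s : DyadicTime, t < s → (s : ℝ≥0) < u → f s = l := by
  by_contra! h
  have key : ∀ (M : ℕ) (u : ℝ≥0), t < u → HasOscillations f M u := by
    intro M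
    induction M with
    | zero => exact fun _ _ => trivial
    | succ M ih =>
      intro u hu
      obtain ⟨s', hs', hsu'⟩ := exists_dyadicTime_between hu
      obtain ⟨s, hs, hss', hne⟩ := h (f s') s' hs'
      exact ⟨s, s', hss', hsu'.le, hne, ih s hs⟩
  obtain ⟨N, hN⟩ := exists_nat_gt t
  obtain ⟨M, hM⟩ := hf.1 N
  exact hM (key M N hN)

theorem exists_const_left {f : DyadicTime → S} (hf : f ∈ regularPaths S) {t : ℝ≥0} (ht : 0 < t) :
    ∃ l, ∃ a < t, ∀ s : DyadicTime, a < s → (s : ℝ≥0) < t → f s = l := by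
  by_contra! h
  have key : ∀ M : ℕ, ∃ b < t, HasOscillations f M b := by
    intro M
    induction M with
    | zero => exact ⟨0, ht, trivial⟩
    | succ M ih =>
      obtain ⟨b, hb, hM⟩ := ih
      obtain ⟨s, hs, hst⟩ := exists_dyadicTime_between hb
      obtain ⟨s', hs', hst', hne⟩ := h (f s) s hst
      exact ⟨s', hst', s, s', hs', le_rfl, hne.symm, hM.mono hs.le⟩
  obtain ⟨N, hN⟩ := exists_nat_gt t
  obtain ⟨M, hM⟩ := hf.1 N
  obtain ⟨b, hb, hbM⟩ := key M
  exact hM (hbM.mono (hb.trans hN).le)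

end Oscillations

section PathSpace

variable {S : Type*} [TopologicalSpace S]

/-- The restriction of a path to the dyadic times. -/
def dyadicRestrict (f : SkorokhodSpace S) : DyadicTime → S := fun t => f t

theorem measurable_eval [MeasurableSpace S] (t : ℝ≥0) :
    Measurable fun f : SkorokhodSpace S => f t := by
  rw [measurable_iff_comap_le]
  exact le_iSup (fun t : ℝ≥0 =>
    MeasurableSpace.comap (fun f : SkorokhodSpace S => f t) inferInstance) t

theorem measurable_dyadicRestrict [MeasurableSpace S] :
    Measurable (dyadicRestrict : SkorokhodSpace S → DyadicTime → S) :=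
  measurable_pi_lambda _ fun t => measurable_eval (t : ℝ≥0)

variable [DiscreteTopology S]

theorem SkorokhodSpace.exists_right (f : SkorokhodSpace S) (t : ℝ≥0) :
    ∃ u > t, ∀ s, t ≤ s → s < u → f s = f t := by
  have h1 : {s | f s = f t} ∈ 𝓝[≥] t := (f.2 t).1 (isOpen_discrete {f t} |>.mem_nhds rfl)
  obtain ⟨u, hu, h2⟩ := (mem_nhdsGE_iff_exists_Ico_subset).1 h1
  exact ⟨u, hu, fun s hs hsu => h2 ⟨hs, hsu⟩⟩

theorem SkorokhodSpace.exists_left (f : SkorokhodSpace S) {t : ℝ≥0} (ht : 0 < t) :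
    ∃ l, ∃ a < t, ∀ s, a < s → s < t → f s = l := by
  obtain ⟨l, hl⟩ := (f.2 t).2
  have h1 : {s | f s = l} ∈ 𝓝[<] t := hl (isOpen_discrete {l} |>.mem_nhds rfl)
  obtain ⟨a, ha, h2⟩ := (mem_nhdsLT_iff_exists_Ioo_subset' ht).1 h1
  exact ⟨l, a, ha, fun s hs hst => h2 ⟨hs, hst⟩⟩

/-- A path in `D(ℝ₊, S)` is constant on a one-sided neighbourhood of any time, so no time can be the
first one around which the oscillations accumulate. -/
theorem exists_not_hasOscillations (f : SkorokhodSpace S) (b : ℝ≥0) :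
    ∃ M, ¬ HasOscillations (dyadicRestrict f) M b := by
  by_contra! hb
  -- the first time before which the number of oscillations is unbounded
  set A : Set ℝ≥0 := {t | ∀ M, HasOscillations (dyadicRestrict f) M t} with hA
  set t := sInf A with ht
  have hlt : ∀ s < t, ∃ M, ¬ HasOscillations (dyadicRestrict f) M s := by
    intro s hs
    by_contra! h
    exact not_le.2 hs (csInf_le (OrderBot.bddBelow A) h)
  have hgt : ∀ u > t, ∀ M, HasOscillations (dyadicRestrict f) M u := by
    intro u hu M
    obtain ⟨s, hs, hsu⟩ := exists_lt_of_csInf_lt (show A.Nonempty from ⟨b, Set.mem_ofPred.2 hb⟩) hu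
    exact (hs M).mono hsu.le
  have hM : ∃ M, ¬ HasOscillations (dyadicRestrict f) M t := by
    rcases eq_zero_or_pos t with h0 | h0
    · refine ⟨1, ?_⟩
      rintro ⟨s, s', h1, h2, -⟩
      rw [h0] at h2
      exact not_lt_zero (lt_of_lt_of_le (Subtype.coe_lt_coe.2 h1) h2)
    · obtain ⟨l, a, ha, hl⟩ := f.exists_left h0
      obtain ⟨c, hac, hct⟩ := exists_between ha
      obtain ⟨M, hM⟩ := hlt c hct
      have key : ∀ s : DyadicTime, (s : ℝ≥0) < t →
          ¬ HasOscillations (dyadicRestrict f) (M + 1) s := by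
        rintro u hu ⟨s, s', h1, h2, h3, h4⟩
        have h5 : c < s := by
          by_contra! h
          exact hM (h4.mono h)
        have h6 : (s : ℝ≥0) < s' := h1
        exact h3 ((hl s (hac.trans h5) ((h6.trans_le h2).trans hu)).trans
          (hl s' (hac.trans (h5.trans h6)) (h2.trans_lt hu)).symm)
      refine ⟨M + 2, ?_⟩
      rintro ⟨s, s', h1, h2, h3, h4⟩
      exact key s (lt_of_lt_of_le (Subtype.coe_lt_coe.2 h1) h2) h4
  obtain ⟨M, hM⟩ := hM
  obtain ⟨u, hu, hfu⟩ := f.exists_right t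
  obtain ⟨v, htv, hvu⟩ := exists_between hu
  obtain ⟨s, s', h1, h2, h3, h4⟩ := hgt v htv (M + 1)
  have h5 : t < s := by
    by_contra! h
    exact hM (h4.mono h)
  have h6 : (s : ℝ≥0) < s' := h1
  exact h3 ((hfu s h5.le ((h6.trans_le h2).trans hvu)).trans
    (hfu s' (h5.trans h6).le (h2.trans_lt hvu)).symm)

theorem dyadicRestrict_mem_regularPaths (f : SkorokhodSpace S) :
    dyadicRestrict f ∈ regularPaths S := by
  refine ⟨fun N => exists_not_hasOscillations f N, fun t => ?_⟩
  obtain ⟨u, hu, hfu⟩ := f.exists_right t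
  obtain ⟨v, htv, hvu⟩ := exists_dyadicTime_between hu
  exact ⟨v, htv, fun s hs hsv => hfu s hs ((Subtype.coe_lt_coe.2 hsv).trans hvu)⟩

theorem range_dyadicRestrict :
    Set.range (dyadicRestrict : SkorokhodSpace S → DyadicTime → S) = regularPaths S := by
  refine Set.Subset.antisymm (Set.range_subset_iff.2 dyadicRestrict_mem_regularPaths) ?_
  intro f hf
  choose g u hu hg using exists_const_right hf
  have hgf : ∀ t : DyadicTime, g t = f t := by
    intro t
    obtain ⟨v, htv, hv⟩ := hf.2 t
    obtain ⟨s, hs, hs'⟩ := exists_dyadicTime_between (lt_min (hu t) htv)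
    rw [← hg t s hs (hs'.trans_le (min_le_left _ _))]
    exact hv s hs.le (hs'.trans_le (min_le_right _ _))
  have hconst : ∀ (a b : ℝ≥0) (l : S), (∀ s : DyadicTime, a < s → (s : ℝ≥0) < b → f s = l) →
      ∀ t, a ≤ t → t < b → g t = l := by
    intro a b l h t hat htb
    obtain ⟨s, hs, hs'⟩ := exists_dyadicTime_between (lt_min (hu t) htb)
    rw [← hg t s hs (hs'.trans_le (min_le_left _ _))]
    exact h s (hat.trans_lt hs) (hs'.trans_le (min_le_right _ _))
  refine ⟨⟨g, fun t => ⟨?_, ?_⟩⟩, funext hgf⟩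
  · refine tendsto_nhds_of_eventually_eq ?_
    filter_upwards [Ico_mem_nhdsGE (hu t)] with s hs
    exact hconst t (u t) (g t) (hg t) s hs.1 hs.2
  · rcases eq_zero_or_pos t with rfl | ht
    · refine ⟨g 0, ?_⟩
      rw [show Set.Iio (0 : ℝ≥0) = ∅ from Set.Iio_bot, nhdsWithin_empty]
      exact tendsto_bot
    · obtain ⟨l, a, ha, hl⟩ := exists_const_left hf ht
      refine ⟨l, tendsto_nhds_of_eventually_eq ?_⟩
      filter_upwards [Ioo_mem_nhdsLT ha] with s hs
      exact hconst a t l hl s hs.1.le hs.2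

theorem pathRel_of_dyadic {r : S → S → Prop} {f g : SkorokhodSpace S}
    (h : ∀ t : DyadicTime, r (f t) (g t)) : PathRel r f g := by
  intro t
  obtain ⟨u, hu, hf⟩ := f.exists_right t
  obtain ⟨v, hv, hg⟩ := g.exists_right t
  obtain ⟨s, hs, hs'⟩ := exists_dyadicTime_between (lt_min hu hv)
  rw [← hf s hs.le (hs'.trans_le (min_le_left _ _)), ← hg s hs.le (hs'.trans_le (min_le_right _ _))]
  exact h s

/-- Right-continuity makes the evaluation at any time a limit of evaluations at dyadic times. -/
theorem comap_dyadicRestrict [MeasurableSpace S] [MeasurableSingletonClass S] [Countable S] :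
    MeasurableSpace.comap (dyadicRestrict : SkorokhodSpace S → DyadicTime → S) inferInstance =
      (inferInstance : MeasurableSpace (SkorokhodSpace S)) := by
  refine le_antisymm measurable_dyadicRestrict.comap_le (iSup_le fun t => ?_)
  rw [← measurable_iff_comap_le]
  have hex : ∀ n : ℕ, ∃ s : DyadicTime, t < s ∧ (s : ℝ≥0) < t + 1 / (n + 1) := fun n =>
    exists_dyadicTime_between (lt_add_of_pos_right t (by positivity))
  choose s hs hs' using hex
  refine @measurable_to_countable' _ _ _ _ (_) _ fun x => ?_
  have : (fun f : SkorokhodSpace S => f t) ⁻¹' {x} =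
      dyadicRestrict ⁻¹' {f | ∃ N : ℕ, ∀ n ≥ N, f (s n) = x} := by
    ext f
    obtain ⟨u, hu, hf⟩ := f.exists_right t
    obtain ⟨N, hN⟩ := exists_nat_one_div_lt (tsub_pos_of_lt hu)
    have hn : ∀ n ≥ N, f (s n) = f t := by
      intro n hn
      refine hf _ (hs n).le ((hs' n).trans ?_)
      have h1 : (1 : ℝ≥0) / (n + 1) ≤ 1 / (N + 1) := by gcongr
      rw [add_comm]
      exact lt_tsub_iff_right.1 (h1.trans_lt hN)
    constructor
    · rintro rfl
      exact ⟨N, hn⟩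
    · rintro ⟨N', hN'⟩
      exact (hn (max N N') (le_max_left _ _)).symm.trans (hN' _ (le_max_right _ _))
  rw [this]
  refine ⟨_, measurableSet_setOfPred.2 ?_, rfl⟩
  exact Measurable.exists fun N => Measurable.forall fun n => Measurable.forall fun _ =>
    measurable_apply_eq (s n) x

end PathSpace

/-! ### Coupling two Markov processes through a common lift -/

section Coupling

/-- The position of the dyadic time `t` in the grid `0, 2⁻ᵏ, 2 · 2⁻ᵏ, …, 2ᵏ` (capped at the last
grid point). -/
noncomputable def gridIndex (k : ℕ) (t : DyadicTime) : Fin (4 ^ k + 1) :=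
  ⟨min ⌊(t : ℝ≥0) * 2 ^ k⌋₊ (4 ^ k), Nat.lt_succ_of_le (min_le_right _ _)⟩

theorem eventually_gridIndex (t : DyadicTime) :
    ∀ᶠ k : ℕ in atTop, ((gridIndex k t : ℕ) : ℝ≥0) * (2 ^ k)⁻¹ = t := by
  obtain ⟨_, ⟨j, a⟩, rfl⟩ := t
  filter_upwards [eventually_ge_atTop (max a j)] with k hk
  have ha : a ≤ k := (le_max_left _ _).trans hk
  have hj : j ≤ k := (le_max_right _ _).trans hk
  have h2 : (2 : ℝ≥0) ^ k = 2 ^ a * 2 ^ (k - a) := by rw [← pow_add, Nat.add_sub_cancel' ha]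
  have h3 : (j : ℝ≥0) / 2 ^ a * 2 ^ k = ((j * 2 ^ (k - a) : ℕ) : ℝ≥0) := by
    rw [h2]
    push_cast
    field_simp
  have h4 : j * 2 ^ (k - a) ≤ 4 ^ k := by
    rw [show (4 : ℕ) = 2 * 2 from rfl, mul_pow]
    exact Nat.mul_le_mul (Nat.lt_two_pow_self.le.trans (Nat.pow_le_pow_right two_pos hj))
      (Nat.pow_le_pow_right two_pos (Nat.sub_le k a))
  have h5 : (gridIndex k ⟨_, ⟨j, a⟩, rfl⟩ : ℕ) = j * 2 ^ (k - a) := by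
    simp only [gridIndex]
    rw [h3, Nat.floor_natCast, min_eq_left h4]
  rw [h5, ← h3, mul_assoc, mul_inv_cancel₀ (by positivity), mul_one]

/-- The law of the first `n + 1` steps of the Markov chain with initial weights `ν` and transition
matrix `M`, both of which have to be nonnegative: `ENNReal.ofReal` sends negative weights to `0`. -/
noncomputable def chainMeasure {C : Type*} [Fintype C] [MeasurableSpace C] (M : Matrix C C ℝ)
    (ν : C → ℝ) (n : ℕ) : Measure (Fin (n + 1) → C) :=
  ∑ z : Fin (n + 1) → C,
    ENNReal.ofReal (ν (z 0) * ∏ j : Fin n, M (z j.castSucc) (z j.succ)) • Measure.dirac z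

theorem IsMarkovProcess.measurable_apply {Ω S : Type*} [MeasurableSpace Ω] {P : Measure Ω}
    [Fintype S] [DecidableEq S] [TopologicalSpace S] [MeasurableSpace S] {Q : Matrix S S ℝ}
    {X : Ω → SkorokhodSpace S} (hX : IsMarkovProcess P Q X) (t : ℝ≥0) :
    Measurable fun ω => X ω t :=
  (measurable_eval t).comp hX.measurable

variable {Ω : Type*} [MeasurableSpace Ω] {P : Measure Ω} [IsProbabilityMeasure P]
  {S : Type*} [Fintype S] [DecidableEq S] [TopologicalSpace S]
  [MeasurableSpace S] [MeasurableSingletonClass S]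
  {C : Type*} [Fintype C] [DecidableEq C] [MeasurableSpace C] [DiscreteMeasurableSpace C]
  {Q : Matrix S S ℝ} {R : Matrix C C ℝ} {X : Ω → SkorokhodSpace S} {p : C → S} {ν : C → ℝ}

/-- If the generator `R` on `C` is lumped to `Q` by the map `p`, then `p` maps the chain obtained by
sampling the `R`-process at multiples of `h` to the corresponding samples of the `Q`-process. -/
theorem map_chainMeasure (hX : IsMarkovProcess P Q X) (hR : ∀ i j, i ≠ j → 0 ≤ R i j)
    (hRQ : ∀ f : S → ℝ, R.mulVec (f ∘ p) = (Q.mulVec f) ∘ p) (hν : ∀ c, 0 ≤ ν c)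
    (hν0 : ∀ s, ∑ c, (if p c = s then ν c else 0) = P.real {ω | X ω 0 = s}) (h : ℝ≥0) (n : ℕ) :
    (chainMeasure (NormedSpace.exp ((h : ℝ) • R)) ν n).map (fun z => p ∘ z) =
      P.map fun ω (j : Fin (n + 1)) => X ω ((j : ℕ) * h) := by
  have hJ : ((h : ℝ) • R) * (Matrix.of fun c s => if p c = s then (1 : ℝ) else 0) =
      (Matrix.of fun c s => if p c = s then (1 : ℝ) else 0) * ((h : ℝ) • Q) := by
    rw [Matrix.smul_mul, Matrix.mul_smul]
    congr 1
    ext c s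
    have := congrFun (hRQ (Pi.single s 1)) c
    simp only [Matrix.mulVec_single_one, Function.comp] at this
    simp only [Matrix.mul_apply, Matrix.of_apply, ite_mul, one_mul, zero_mul, Finset.sum_ite_eq,
      Finset.mem_univ, if_true]
    rw [← Matrix.col_apply Q, ← this]
    simp [Matrix.mulVec, dotProduct, Pi.single_apply]
  have hexp := exp_mul_of_intertwine hJ
  have hlump : ∀ c s, ∑ c', (if p c' = s then NormedSpace.exp ((h : ℝ) • R) c c' else 0) =
      NormedSpace.exp ((h : ℝ) • Q) (p c) s := by
    intro c s
    have := congrFun (congrFun hexp c) s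
    simpa [Matrix.mul_apply] using this
  refine Measure.ext_of_singleton fun x => ?_
  have hm : Measurable fun ω (j : Fin (n + 1)) => X ω ((j : ℕ) * h) :=
    measurable_pi_lambda _ fun j => hX.measurable_apply _
  have hw : ∀ z : Fin (n + 1) → C, 0 ≤ ν (z 0) *
      ∏ j : Fin n, NormedSpace.exp ((h : ℝ) • R) (z j.castSucc) (z j.succ) := fun z =>
    mul_nonneg (hν _) (Finset.prod_nonneg fun j _ => exp_smul_apply_nonneg hR h.2 _ _)
  rw [Measure.map_apply (Measurable.of_discrete) (measurableSet_singleton x),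
    Measure.map_apply hm (measurableSet_singleton x)]
  have h1 : (fun ω (j : Fin (n + 1)) => X ω ((j : ℕ) * h)) ⁻¹' {x} =
      {ω | ∀ j : Fin (n + 1), X ω ((j : ℕ) * h) = x j} := by
    ext ω
    exact funext_iff
  have h2 := hX.finiteDimensional n (fun j => (j : ℕ) * h) x (by
    intro i j hij
    have : ((i : ℕ) : ℝ≥0) ≤ (j : ℕ) := by exact_mod_cast hij
    simp only
    gcongr)
  have h3 : ∀ j : Fin n, ((((j.succ : Fin (n + 1)) : ℕ) * h : ℝ≥0) : ℝ) -
      ((((j.castSucc : Fin (n + 1)) : ℕ) * h : ℝ≥0) : ℝ) = h := by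
    intro j
    push_cast
    simp
    ring
  simp only [h3, Fin.val_zero, Nat.cast_zero, zero_mul] at h2
  rw [h1, ← ENNReal.ofReal_toReal (measure_ne_top P _), ← Measure.real, h2, ← hν0,
    ← sum_fiber_markov p _ _ hlump, ENNReal.ofReal_sum_of_nonneg]
  · simp only [chainMeasure, Measure.coe_finsetSum, Finset.sum_apply, Measure.smul_apply,
      smul_eq_mul]
    refine Finset.sum_congr rfl fun z _ => ?_
    rw [Measure.dirac_apply' _ (MeasurableSet.of_discrete)]
    by_cases hz : p ∘ z = x
    · rw [Set.indicator_of_mem (show z ∈ _ from hz), if_pos hz]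
      simp
    · rw [Set.indicator_of_notMem (show z ∉ _ from hz), if_neg hz]
      simp
  · intro z _
    split_ifs
    · exact hw z
    · exact le_rfl

/-- The law of the chain sampled at step `2⁻ᵏ`, as a law of functions on the dyadic times. -/
noncomputable def gridMeasure (R : Matrix C C ℝ) (ν : C → ℝ) (k : ℕ) : Measure (DyadicTime → C) :=
  (chainMeasure (NormedSpace.exp ((((2 ^ k)⁻¹ : ℝ≥0) : ℝ) • R)) ν (4 ^ k)).map
    fun z t => z (gridIndex k t)

theorem map_gridMeasure (hX : IsMarkovProcess P Q X) (hR : ∀ i j, i ≠ j → 0 ≤ R i j)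
    (hRQ : ∀ f : S → ℝ, R.mulVec (f ∘ p) = (Q.mulVec f) ∘ p) (hν : ∀ c, 0 ≤ ν c)
    (hν0 : ∀ s, ∑ c, (if p c = s then ν c else 0) = P.real {ω | X ω 0 = s}) (k : ℕ) :
    (gridMeasure R ν k).map (fun z => p ∘ z) =
      P.map fun ω t => X ω (((gridIndex k t : ℕ) : ℝ≥0) * (2 ^ k)⁻¹) := by
  have hp : Measurable fun z : DyadicTime → C => p ∘ z :=
    measurable_pi_lambda _ fun t => Measurable.of_discrete.comp (measurable_pi_apply t)
  rw [gridMeasure, Measure.map_map hp (measurable_pi_lambda _ fun t => measurable_pi_apply _)]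
  have h1 := map_chainMeasure hX hR hRQ hν hν0 ((2 ^ k)⁻¹) (4 ^ k)
  have h2 := congrArg (Measure.map fun (x : Fin (4 ^ k + 1) → S) t => x (gridIndex k t)) h1
  rw [Measure.map_map (measurable_pi_lambda _ fun t => measurable_pi_apply _)
    Measurable.of_discrete, Measure.map_map
    (measurable_pi_lambda _ fun t => measurable_pi_apply _)
    (measurable_pi_lambda _ fun j => hX.measurable_apply _)] at h2
  exact h2

theorem isProbabilityMeasure_gridMeasure (hX : IsMarkovProcess P Q X)
    (hR : ∀ i j, i ≠ j → 0 ≤ R i j)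
    (hRQ : ∀ f : S → ℝ, R.mulVec (f ∘ p) = (Q.mulVec f) ∘ p) (hν : ∀ c, 0 ≤ ν c)
    (hν0 : ∀ s, ∑ c, (if p c = s then ν c else 0) = P.real {ω | X ω 0 = s}) (k : ℕ) :
    IsProbabilityMeasure (gridMeasure R ν k) := by
  have hp : Measurable fun z : DyadicTime → C => p ∘ z :=
    measurable_pi_lambda _ fun t => Measurable.of_discrete.comp (measurable_pi_apply t)
  have hm : Measurable fun ω (t : DyadicTime) => X ω (((gridIndex k t : ℕ) : ℝ≥0) * (2 ^ k)⁻¹) :=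
    measurable_pi_lambda _ fun t => hX.measurable_apply _
  constructor
  have h := congrArg (fun μ => μ Set.univ) (map_gridMeasure hX hR hRQ hν hν0 k)
  simp only [Measure.map_apply hp MeasurableSet.univ, Measure.map_apply hm MeasurableSet.univ,
    Set.preimage_univ, measure_univ] at h
  exact h

variable [DiscreteTopology S] [TopologicalSpace C] [DiscreteTopology C]

/-- Each finite-dimensional distribution is constant along the sequence eventually, so it passes to
any weak limit. -/
theorem map_eq_of_tendsto_gridMeasure (hX : IsMarkovProcess P Q X)
    (hR : ∀ i j, i ≠ j → 0 ≤ R i j)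
    (hRQ : ∀ f : S → ℝ, R.mulVec (f ∘ p) = (Q.mulVec f) ∘ p) (hν : ∀ c, 0 ≤ ν c)
    (hν0 : ∀ s, ∑ c, (if p c = s then ν c else 0) = P.real {ω | X ω 0 = s})
    {𝒰 : Filter ℕ} [𝒰.NeBot] (h𝒰 : 𝒰 ≤ atTop)
    {π : ℕ → ProbabilityMeasure (DyadicTime → C)} (hπ : ∀ k, (π k : Measure _) = gridMeasure R ν k)
    {π' : ProbabilityMeasure (DyadicTime → C)} (hlim : Tendsto π 𝒰 (𝓝 π')) :
    (π' : Measure (DyadicTime → C)).map (fun z => p ∘ z) =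
      P.map fun ω => dyadicRestrict (X ω) := by
  have hpm : Measurable fun z : DyadicTime → C => p ∘ z :=
    measurable_pi_lambda _ fun t => Measurable.of_discrete.comp (measurable_pi_apply t)
  have hXm : Measurable fun ω => dyadicRestrict (X ω) :=
    measurable_dyadicRestrict.comp hX.measurable
  have := Measure.isFiniteMeasure_map P fun ω => dyadicRestrict (X ω)
  refine IsProjectiveLimit.unique (P := fun I : Finset DyadicTime =>
    (P.map fun ω => dyadicRestrict (X ω)).map I.restrict) (fun I => ?_) (fun I => rfl)
  have hI : Measurable (I.restrict : (DyadicTime → S) → (I → S)) := Finset.measurable_restrict I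
  have hc : Continuous fun z : DyadicTime → C => I.restrict (p ∘ z) :=
    continuous_pi fun t => (continuous_of_discreteTopology (f := p)).comp (continuous_apply t.1)
  have hlim' := ProbabilityMeasure.tendsto_map_of_tendsto_of_continuous π π' hlim hc
  have hev : ∀ᶠ k in 𝒰, (π k).map hc.measurable.aemeasurable =
      ProbabilityMeasure.map (⟨P, inferInstance⟩ : ProbabilityMeasure Ω)
        (hI.comp hXm).aemeasurable := by
    have : ∀ᶠ k in 𝒰, ∀ t ∈ I, ((gridIndex k t : ℕ) : ℝ≥0) * (2 ^ k)⁻¹ = t :=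
      (Filter.eventually_all_finset I).2 fun t _ => h𝒰 (eventually_gridIndex t)
    filter_upwards [this] with k hk
    refine Subtype.ext ?_
    show (π k : Measure _).map ((I.restrict : (DyadicTime → S) → (I → S)) ∘ fun z => p ∘ z) =
      P.map ((I.restrict : (DyadicTime → S) → (I → S)) ∘ fun ω => dyadicRestrict (X ω))
    rw [← Measure.map_map hI hpm, hπ, map_gridMeasure hX hR hRQ hν hν0,
      Measure.map_map hI (measurable_pi_lambda _ fun t => hX.measurable_apply _)]
    congr 1
    funext ω t
    simp only [Function.comp, Finset.restrict, dyadicRestrict]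
    rw [hk t t.2]
  have heq := tendsto_nhds_unique hlim' (tendsto_nhds_of_eventually_eq hev)
  have heq' := congrArg (fun μ : ProbabilityMeasure _ => (μ : Measure (I → S))) heq
  simp only [ProbabilityMeasure.toMeasure_map] at heq'
  rw [Measure.map_map hI hpm]
  exact heq'.trans (Measure.map_map hI hXm).symm

end Coupling

/-- Two Markov processes whose initial states are related by `r` are stochastically ordered, if some
generator `R` on the set of related pairs has the two given generators as its marginals. -/
theorem stochLE_of_coupling {Ω : Type*} [MeasurableSpace Ω] {P : Measure Ω} [IsProbabilityMeasure P]
    {S : Type*} [Fintype S] [DecidableEq S] [TopologicalSpace S] [DiscreteTopology S]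
    [MeasurableSpace S] [MeasurableSingletonClass S] {r : S → S → Prop}
    [Fintype {c : S × S // r c.1 c.2}]
    {Q Q' : Matrix S S ℝ} {R : Matrix {c : S × S // r c.1 c.2} {c : S × S // r c.1 c.2} ℝ}
    (hR : ∀ i j, i ≠ j → 0 ≤ R i j)
    (hRQ : ∀ f : S → ℝ, R.mulVec (fun c => f c.1.1) = fun c => Q.mulVec f c.1.1)
    (hRQ' : ∀ f : S → ℝ, R.mulVec (fun c => f c.1.2) = fun c => Q'.mulVec f c.1.2)
    {X Y : Ω → SkorokhodSpace S} (hX : IsMarkovProcess P Q X) (hY : IsMarkovProcess P Q' Y)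
    (h0 : ∀ᵐ ω ∂P, r (X ω 0) (Y ω 0)) : StochLE P (PathRel r) X Y := by
  intro φ hφ ⟨B, hB⟩ hmono
  have : SecondCountableTopology {c : S × S // r c.1 c.2} := inferInstance
  have : CompactSpace {c : S × S // r c.1 c.2} := inferInstance
  have : BorelSpace {c : S × S // r c.1 c.2} := inferInstance
  set ν : {c : S × S // r c.1 c.2} → ℝ := fun c => P.real {ω | X ω 0 = c.1.1 ∧ Y ω 0 = c.1.2}
    with hν_def
  have hν : ∀ c, 0 ≤ ν c := fun c => measureReal_nonneg
  have hms : ∀ a b, MeasurableSet {ω | X ω 0 = a ∧ Y ω 0 = b} := fun a b =>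
    ((hX.measurable_apply 0) (measurableSet_singleton a)).inter
      ((hY.measurable_apply 0) (measurableSet_singleton b))
  have hν_sum : ∀ (A : S × S → Prop) [DecidablePred A],
      ∑ c : {c : S × S // r c.1 c.2}, (if A c.1 then ν c else 0) =
        P.real {ω | A (X ω 0, Y ω 0)} := by
    intro A _
    classical
    have h1 : {ω | A (X ω 0, Y ω 0)} =ᵐ[P] ⋃ c ∈ Finset.univ.filter
        (fun c : {c : S × S // r c.1 c.2} => A c.1), {ω | X ω 0 = c.1.1 ∧ Y ω 0 = c.1.2} := by
      filter_upwards [h0] with ω hω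
      refine propext ?_
      show A (X ω 0, Y ω 0) ↔ ω ∈ ⋃ c ∈ Finset.univ.filter
        (fun c : {c : S × S // r c.1 c.2} => A c.1), {ω | X ω 0 = c.1.1 ∧ Y ω 0 = c.1.2}
      simp only [Set.mem_iUnion]
      constructor
      · intro hA
        exact ⟨⟨(X ω 0, Y ω 0), hω⟩, by simpa using hA, rfl, rfl⟩
      · rintro ⟨⟨⟨a, b⟩, hc⟩, hA, h1, h2⟩
        have hA' : A (a, b) := by simpa using hA
        dsimp only at h1 h2
        rwa [h1, h2]
    rw [measureReal_congr h1, measureReal_biUnion_finset _ (fun c _ => hms _ _),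
      Finset.sum_filter]
    intro c _ d _ hcd
    refine Set.disjoint_left.2 fun ω h1 h2 => hcd (Subtype.ext (Prod.ext ?_ ?_))
    · exact h1.1.symm.trans h2.1
    · exact h1.2.symm.trans h2.2
  have hνX : ∀ s, ∑ c : {c : S × S // r c.1 c.2}, (if c.1.1 = s then ν c else 0) =
      P.real {ω | X ω 0 = s} := fun s => hν_sum (fun c => c.1 = s)
  have hνY : ∀ s, ∑ c : {c : S × S // r c.1 c.2}, (if c.1.2 = s then ν c else 0) =
      P.real {ω | Y ω 0 = s} := fun s => hν_sum (fun c => c.2 = s)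
  -- a weak limit of the laws of the sampled coupled chains
  obtain ⟨π, hπX, hπY⟩ : ∃ π : ProbabilityMeasure (DyadicTime → {c : S × S // r c.1 c.2}),
      (π : Measure _).map
        (fun (z : DyadicTime → {c : S × S // r c.1 c.2}) t => (z t).1.1) = P.map (fun ω => dyadicRestrict (X ω)) ∧
      (π : Measure _).map
        (fun (z : DyadicTime → {c : S × S // r c.1 c.2}) t => (z t).1.2) = P.map (fun ω => dyadicRestrict (Y ω)) := by
    let π : ℕ → ProbabilityMeasure (DyadicTime → {c : S × S // r c.1 c.2}) := fun k =>
      ⟨gridMeasure R ν k, isProbabilityMeasure_gridMeasure (p := fun c : {c : S × S // r c.1 c.2} => c.1.1) hX hR hRQ hν hνX k⟩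
    obtain ⟨π', -, hπ'⟩ := isCompact_univ.ultrafilter_le_nhds ((hyperfilter ℕ).map π) (by simp)
    have hU : (hyperfilter ℕ : Filter ℕ) ≤ atTop := by
      rw [← Nat.cofinite_eq_atTop]
      exact hyperfilter_le_cofinite
    exact ⟨π', map_eq_of_tendsto_gridMeasure (p := fun c : {c : S × S // r c.1 c.2} => c.1.1) hX hR hRQ hν hνX hU
      (fun _ => rfl) hπ', map_eq_of_tendsto_gridMeasure (p := fun c : {c : S × S // r c.1 c.2} => c.1.2) hY hR hRQ' hν hνY hU
      (fun _ => rfl) hπ'⟩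
  have hφ' : Measurable[MeasurableSpace.comap (dyadicRestrict : SkorokhodSpace S → DyadicTime → S)
    inferInstance] φ := hφ.mono comap_dyadicRestrict.ge le_rfl
  obtain ⟨ψ, hψ, rfl⟩ := Measurable.exists_eq_measurable_comp (f := dyadicRestrict) hφ'
  have hp : Measurable fun (z : DyadicTime → {c : S × S // r c.1 c.2}) t => (z t).1.1 :=
    measurable_pi_lambda _ fun t => (measurable_fst.comp measurable_subtype_coe).comp
      (measurable_pi_apply t)
  have hq : Measurable fun (z : DyadicTime → {c : S × S // r c.1 c.2}) t => (z t).1.2 :=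
    measurable_pi_lambda _ fun t => (measurable_snd.comp measurable_subtype_coe).comp
      (measurable_pi_apply t)
  -- transfer along equality of laws
  have key : ∀ {Z : Ω → SkorokhodSpace S} {g : (DyadicTime → {c : S × S // r c.1 c.2}) →
      DyadicTime → S}, Measurable Z → Measurable g →
      (π : Measure _).map g = P.map (fun ω => dyadicRestrict (Z ω)) →
      (∫ ω, ψ (dyadicRestrict (Z ω)) ∂P = ∫ z, ψ (g z) ∂π) ∧ Integrable (fun z => ψ (g z)) π ∧
      ∀ᵐ z ∂(π : Measure _), g z ∈ regularPaths S := by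
    intro Z g hZ hg hlaw
    have hZ' : Measurable fun ω => dyadicRestrict (Z ω) := measurable_dyadicRestrict.comp hZ
    refine ⟨?_, ?_, ?_⟩
    · rw [← integral_map hZ'.aemeasurable hψ.aestronglyMeasurable, ← hlaw,
        integral_map hg.aemeasurable hψ.aestronglyMeasurable]
    · have h1 : Integrable ψ ((π : Measure _).map g) := by
        rw [hlaw, integrable_map_measure hψ.aestronglyMeasurable hZ'.aemeasurable]
        exact Integrable.of_bound (hψ.comp hZ').aestronglyMeasurable B
          (Eventually.of_forall fun ω => hB (Z ω))
      exact (integrable_map_measure hψ.aestronglyMeasurable hg.aemeasurable).1 h1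
    · have h1 : ∀ᵐ f ∂((π : Measure _).map g), f ∈ regularPaths S := by
        rw [hlaw]
        exact (ae_map_iff (p := (· ∈ regularPaths S)) hZ'.aemeasurable
          measurableSet_regularPaths).2
          (Eventually.of_forall fun ω => dyadicRestrict_mem_regularPaths (Z ω))
      exact (ae_map_iff (p := (· ∈ regularPaths S)) hg.aemeasurable
        measurableSet_regularPaths).1 h1
  obtain ⟨hX1, hX2, hX3⟩ := key hX.measurable hp hπX
  obtain ⟨hY1, hY2, hY3⟩ := key hY.measurable hq hπY
  simp only [Function.comp]
  rw [hX1, hY1]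
  refine integral_mono_ae hX2 hY2 ?_
  filter_upwards [hX3, hY3] with z hzX hzY
  rw [← range_dyadicRestrict] at hzX hzY
  obtain ⟨f, hf⟩ := hzX
  obtain ⟨g, hg⟩ := hzY
  have h := hmono f g (pathRel_of_dyadic fun t => by
    rw [show f t = (z t).1.1 from congrFun hf t, show g t = (z t).1.2 from congrFun hg t]
    exact (z t).2)
  simp only [Function.comp, hf, hg] at h
  exact h

/-! ### The generators of the two loss systems as sums over customers -/

section Model

variable {K : ℕ} {m : Fin K → ℕ} {n : ℕ}

open Classical in
/-- The state `x + e_{i,k}`, or `x` if this is not a state. -/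
noncomputable def plus (i : Fin 2) (k : Fin K) (x : State m n) : State m n :=
  if h : (∀ l, (x.1 + unitVec i k) 0 l ≤ m l) ∧ ∑ l, (x.1 + unitVec i k) 1 l ≤ n then
    ⟨x.1 + unitVec i k, h⟩ else x

/-- The state `x - e_{i,k}`, or `x` if `x_{i,k} = 0`. -/
def minus (i : Fin 2) (k : Fin K) (x : State m n) : State m n :=
  ⟨x.1 - unitVec i k, fun l => (Nat.sub_le _ _).trans (x.2.1 l),
    (Finset.sum_le_sum fun _ _ => Nat.sub_le _ _).trans x.2.2⟩

/-- The state after the arrival of a class-`k` customer. -/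
noncomputable def arrive (k : Fin K) (x : State m n) : State m n :=
  if x.1 0 k < m k then plus 0 k x else if ∑ l, x.1 1 l < n then plus 1 k x else x

/-- The state of the maximum packing system after the departure of a class-`k` customer from
layer `i`. -/
def packingDepart (i : Fin 2) (k : Fin K) (x : State m n) : State m n :=
  if i = 0 ∧ x.1 1 k = 0 then minus 0 k x else minus 1 k x

theorem unitVec_apply (i j : Fin 2) (k l : Fin K) :
    unitVec i k j l = if j = i ∧ l = k then 1 else 0 := by
  unfold unitVec
  by_cases h : j = i
  · subst h
    simp [Pi.single_apply]
  · simp [h]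

theorem total_eq (x : State m n) : total x = ∑ k, x.1 0 k + ∑ k, x.1 1 k := by
  simp [total]

theorem sum_add_unitVec (x : Fin 2 → Fin K → ℕ) (i : Fin 2) (k : Fin K) (j : Fin 2) :
    ∑ l, (x + unitVec i k) j l = ∑ l, x j l + if j = i then 1 else 0 := by
  simp only [Pi.add_apply, unitVec_apply, Finset.sum_add_distrib]
  by_cases h : j = i <;> simp [h]

theorem plus_zero_val {k : Fin K} {x : State m n} (h : x.1 0 k < m k) :
    (plus 0 k x).1 = x.1 + unitVec 0 k := by
  rw [plus, dif_pos]
  constructor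
  · intro l
    have := x.2.1 l
    simp only [Pi.add_apply, unitVec_apply, true_and]
    split_ifs with hl
    · subst hl
      exact h
    · exact this
  · rw [sum_add_unitVec]
    simpa using x.2.2

theorem plus_one_val {k : Fin K} {x : State m n} (h : ∑ l, x.1 1 l < n) :
    (plus 1 k x).1 = x.1 + unitVec 1 k := by
  rw [plus, dif_pos]
  constructor
  · intro l
    simpa [unitVec_apply] using x.2.1 l
  · rw [sum_add_unitVec]
    simpa using h

theorem minus_val_add {i : Fin 2} {k : Fin K} {x : State m n} (h : 0 < x.1 i k) :
    (minus i k x).1 + unitVec i k = x.1 := by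
  funext j l
  simp only [minus, Pi.add_apply, Pi.sub_apply, unitVec_apply]
  split_ifs with hj
  · obtain ⟨rfl, rfl⟩ := hj
    omega
  · omega

theorem total_minus {i : Fin 2} {k : Fin K} {x : State m n} (h : 0 < x.1 i k) :
    total (minus i k x) + 1 = total x := by
  have h1 := sum_add_unitVec (minus i k x).1 i k
  rw [minus_val_add h] at h1
  rw [total_eq, total_eq, h1, h1]
  fin_cases i <;> simp <;> ring

/-- The action of the generator on functions; the two hypotheses say that only transitions to states
have positive rates. -/
theorem generator_mulVec {up down : Fin 2 → Fin K → State m n → ℝ}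
    (hup : ∀ i k x, up i k x ≠ 0 → (plus i k x).1 = x.1 + unitVec i k)
    (hdown : ∀ i k x, x.1 i k = 0 → down i k x = 0) (f : State m n → ℝ) (x : State m n) :
    (generator up down).mulVec f x = ∑ i, ∑ k, (up i k x * (f (plus i k x) - f x) +
      down i k x * (f (minus i k x) - f x)) := by
  have h1 : (generator up down).mulVec f x = ∑ y, jumpRate up down x y * (f y - f x) := by
    rw [Matrix.mulVec, dotProduct, ← Finset.add_sum_erase _ _ (Finset.mem_univ x),
      ← Finset.add_sum_erase Finset.univ (fun y => jumpRate up down x y * (f y - f x))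
        (Finset.mem_univ x), sub_self, mul_zero, zero_add]
    simp only [mul_sub, Finset.sum_sub_distrib]
    rw [← Finset.sum_mul, generator, if_pos rfl]
    have : ∀ y ∈ Finset.univ.erase x, generator up down x y * f y = jumpRate up down x y * f y := by
      intro y hy
      rw [generator, if_neg (Finset.ne_of_mem_erase hy).symm]
    rw [Finset.sum_congr rfl this]
    ring
  rw [h1]
  simp only [jumpRate, Finset.sum_mul]
  rw [Finset.sum_comm]
  refine Finset.sum_congr rfl fun i _ => ?_
  rw [Finset.sum_comm]
  refine Finset.sum_congr rfl fun k _ => ?_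
  simp only [add_mul, Finset.sum_add_distrib, ite_mul, zero_mul]
  congr 1
  · by_cases h : up i k x = 0
    · simp [h]
    · have h2 : ∀ y : State m n, y.1 = x.1 + unitVec i k ↔ y = plus i k x := by
        intro y
        rw [← hup i k x h, Subtype.ext_iff]
      simp [h2]
  · by_cases h : x.1 i k = 0
    · simp [hdown i k x h]
    · have h2 : ∀ y : State m n, x.1 = y.1 + unitVec i k ↔ y = minus i k x := by
        intro y
        rw [Subtype.ext_iff, ← minus_val_add (Nat.pos_of_ne_zero h), add_left_inj, eq_comm]
      simp [h2]

theorem plus_val_of_upRate_ne_zero (lam : Fin K → ℝ) (i : Fin 2) (k : Fin K) (x : State m n)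
    (h : upRate lam i k x ≠ 0) : (plus i k x).1 = x.1 + unitVec i k := by
  have h1 : x ∈ acceptSet m n i k := by
    by_contra h1
    exact h (if_neg h1)
  fin_cases i
  · exact plus_zero_val h1
  · exact plus_one_val h1.2

theorem sum_upRate_mul (lam : Fin K → ℝ) (k : Fin K) (f : State m n → ℝ) (x : State m n) :
    ∑ i, upRate lam i k x * (f (plus i k x) - f x) = lam k * (f (arrive k x) - f x) := by
  have hx := x.2.1 k
  simp only [Fin.sum_univ_two, upRate, acceptSet, Set.mem_ofPred_eq, arrive]
  by_cases h1 : x.1 0 k < m k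
  · simp [h1, h1.ne]
  · have h2 : x.1 0 k = m k := le_antisymm hx (not_lt.1 h1)
    by_cases h3 : ∑ l, x.1 1 l < n <;> simp [h2, h3]

variable {lam mu : Fin K → ℝ} {c : ℝ}

theorem overflowGenerator_mulVec (hmu : ∀ k, mu k = c) (f : State m n → ℝ) (x : State m n) :
    (overflowGenerator m n lam mu).mulVec f x = ∑ k, lam k * (f (arrive k x) - f x) +
      ∑ i, ∑ k, c * x.1 i k * (f (minus i k x) - f x) := by
  rw [overflowGenerator, generator_mulVec (plus_val_of_upRate_ne_zero lam)]
  · simp only [Finset.sum_add_distrib, downRate, hmu]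
    rw [Finset.sum_comm]
    simp only [sum_upRate_mul]
  · intro i k x h
    simp [downRate, h]

theorem packingGenerator_mulVec (hmu : ∀ k, mu k = c) (f : State m n → ℝ) (x : State m n) :
    (packingGenerator m n lam mu).mulVec f x = ∑ k, lam k * (f (arrive k x) - f x) +
      ∑ i, ∑ k, c * x.1 i k * (f (packingDepart i k x) - f x) := by
  rw [packingGenerator, generator_mulVec (plus_val_of_upRate_ne_zero lam)]
  · simp only [Finset.sum_add_distrib]
    rw [Finset.sum_comm]
    simp only [sum_upRate_mul]
    congr 1
    rw [Fin.sum_univ_two, Fin.sum_univ_two, ← Finset.sum_add_distrib, ← Finset.sum_add_distrib]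
    refine Finset.sum_congr rfl fun k _ => ?_
    simp only [downRateMP, hmu, packingDepart]
    by_cases h : x.1 1 k = 0
    · simp [h]
    · simp [h, Nat.pos_of_ne_zero h]
      ring
  · intro i k x h
    fin_cases i
    · simp only [Fin.zero_eta] at h
      simp [downRateMP, h]
    · simp only [Fin.mk_one] at h
      simp [downRateMP, h]

/-! ### The transitions of the two systems preserve the order -/

theorem arrive_apply_zero (k l : Fin K) (x : State m n) :
    (arrive k x).1 0 l = if l = k ∧ x.1 0 k < m k then x.1 0 l + 1 else x.1 0 l := by
  unfold arrive
  split_ifs with h1 h2 h3 h4 h5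
  · rw [plus_zero_val h1]
    simp [unitVec_apply, h2.1]
  · rw [plus_zero_val h1]
    have : l ≠ k := fun h => h2 ⟨h, h1⟩
    simp [unitVec_apply, this]
  · exact absurd h4.2 h1
  · rw [plus_one_val h3]
    simp [unitVec_apply]
  · exact absurd h5.2 h1
  · rfl

theorem total_arrive (k : Fin K) (x : State m n) :
    total (arrive k x) = if x.1 0 k < m k ∨ ∑ l, x.1 1 l < n then total x + 1 else total x := by
  unfold arrive
  by_cases h1 : x.1 0 k < m k
  · rw [if_pos h1, if_pos (Or.inl h1), total_eq, total_eq, plus_zero_val h1, sum_add_unitVec,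
      sum_add_unitVec]
    simp
    ring
  · by_cases h2 : ∑ l, x.1 1 l < n
    · rw [if_neg h1, if_pos h2, if_pos (Or.inr h2), total_eq, total_eq, plus_one_val h2,
        sum_add_unitVec, sum_add_unitVec]
      simp
      ring
    · simp [h1, h2]

/-- The only delicate case is that of an arrival accepted in state `x` and blocked in state `y`. Then
`y` is full, apart from dedicated servers of other classes, which forces `|x| < |y|`. -/
theorem Prec.arrive {x y : State m n} (h : Prec x y) (k : Fin K) :
    Prec (arrive k x) (arrive k y) := by
  refine ⟨fun l => ?_, ?_⟩
  · rw [arrive_apply_zero, arrive_apply_zero]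
    have h1 := h.1 l
    have h2 := y.2.1 l
    split_ifs with h3 h4 h4
    · omega
    · obtain ⟨rfl, h5⟩ := h3
      have : ¬ y.1 0 l < m l := fun h6 => h4 ⟨rfl, h6⟩
      omega
    · omega
    · omega
  · rw [total_arrive, total_arrive]
    have h1 := h.2
    split_ifs with h2 h3 h3
    · omega
    · have h4 : ¬ y.1 0 k < m k := fun h4 => h3 (Or.inl h4)
      have h5 : ¬ ∑ l, y.1 1 l < n := fun h5 => h3 (Or.inr h5)
      rw [total_eq, total_eq]
      have h6 := x.2.2
      rcases h2 with h2 | h2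
      · have : ∑ l, x.1 0 l < ∑ l, y.1 0 l :=
          Finset.sum_lt_sum (fun l _ => h.1 l) ⟨k, Finset.mem_univ k, by omega⟩
        omega
      · have : ∑ l, x.1 0 l ≤ ∑ l, y.1 0 l := Finset.sum_le_sum fun l _ => h.1 l
        omega
    · omega
    · omega

theorem minus_apply_zero_le (i : Fin 2) (k l : Fin K) (x : State m n) :
    (minus i k x).1 0 l ≤ x.1 0 l := Nat.sub_le _ _

theorem prec_packingDepart {x y : State m n} {i : Fin 2} {k : Fin K}
    (h1 : ∀ l, x.1 0 l ≤ y.1 0 l) (h2 : total x < total y) (h3 : 0 < y.1 i k)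
    (h4 : i = 0 → x.1 0 k < y.1 0 k) : Prec x (packingDepart i k y) := by
  unfold packingDepart
  split_ifs with h
  · obtain ⟨rfl, -⟩ := h
    have h5 := total_minus h3
    refine ⟨fun l => ?_, by omega⟩
    have h6 := h4 rfl
    have h7 := h1 l
    simp only [minus, Pi.sub_apply, unitVec_apply, true_and]
    split_ifs with hl
    · subst hl
      omega
    · omega
  · have h3' : 0 < y.1 1 k := by
      fin_cases i
      · exact Nat.pos_of_ne_zero fun h' => h ⟨rfl, h'⟩
      · exact h3
    have h5 := total_minus h3'
    refine ⟨fun l => ?_, by omega⟩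
    simpa [minus, unitVec_apply] using h1 l

/-! ### The coupled generator -/

open Classical in
/-- The generator of a jump process on `E` with moves `l : L`, where the move `l` leads from `c` to
`target l c` at rate `rate l c`. -/
noncomputable def moveGenerator {E L : Type*} [Fintype L] (rate : L → E → ℝ)
    (target : L → E → E) : Matrix E E ℝ :=
  fun c d => ∑ l, rate l c * ((if target l c = d then 1 else 0) - if c = d then 1 else 0)

theorem moveGenerator_nonneg {E L : Type*} [Fintype L] {rate : L → E → ℝ}
    {target : L → E → E} (h : ∀ l c, 0 ≤ rate l c) (c d : E) (hcd : c ≠ d) :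
    0 ≤ moveGenerator rate target c d := by
  refine Finset.sum_nonneg fun l _ => mul_nonneg (h l c) ?_
  rw [if_neg hcd, sub_zero]
  split_ifs <;> norm_num

theorem moveGenerator_mulVec {E L : Type*} [Fintype E] [Fintype L]
    (rate : L → E → ℝ) (target : L → E → E) (f : E → ℝ) (c : E) :
    (moveGenerator rate target).mulVec f c = ∑ l, rate l c * (f (target l c) - f c) := by
  simp only [Matrix.mulVec, dotProduct, moveGenerator, Finset.sum_mul]
  rw [Finset.sum_comm]
  refine Finset.sum_congr rfl fun l _ => ?_
  simp only [mul_assoc, sub_mul, ite_mul, one_mul, zero_mul]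
  classical
  have h : ∀ a : E, ∑ d, (if a = d then f d else 0) = f a := by
    intro a
    rw [Finset.sum_eq_single a (fun d _ hd => if_neg hd.symm)
      (fun ha => absurd (Finset.mem_univ a) ha), if_pos rfl]
  rw [← Finset.mul_sum, Finset.sum_sub_distrib, h, h]

/-- The pairs of states in the order `⪯`. -/
abbrev OrderedPair (m : Fin K → ℕ) (n : ℕ) : Type :=
  {p : State m n × State m n // Prec p.1 p.2}

open Classical in
/-- The pair `(x, y)`, or the pair `p` if `(x, y)` is not ordered. -/
noncomputable def moveTo (p : OrderedPair m n) (x y : State m n) : OrderedPair m n :=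
  if h : Prec x y then ⟨(x, y), h⟩ else p

theorem mul_sub_moveTo {w : ℝ} {p : OrderedPair m n} {x y : State m n} (h : w ≠ 0 → Prec x y)
    (F : State m n × State m n → ℝ) :
    w * (F (moveTo p x y).1 - F p.1) = w * (F (x, y) - F p.1) := by
  by_cases hw : w = 0
  · simp [hw]
  · rw [moveTo, dif_pos (h hw)]

/-- The number of customers at `(i, k)` in the larger state of the pair, except those which are
matched with the layer-1 customers of the smaller state. -/
def unmatched (p : OrderedPair m n) (i : Fin 2) (k : Fin K) : ℝ :=
  p.1.2.1 i k - if i = 0 then (p.1.1.1 0 k : ℝ) else 0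

theorem unmatched_nonneg (p : OrderedPair m n) (i : Fin 2) (k : Fin K) : 0 ≤ unmatched p i k := by
  have h : (p.1.1.1 0 k : ℝ) ≤ p.1.2.1 0 k := by exact_mod_cast p.2.1 k
  fin_cases i
  · simpa [unmatched] using h
  · simp [unmatched]

/-- The number of unmatched customers in the larger state of the pair. -/
def totalUnmatched (p : OrderedPair m n) : ℝ := ∑ i, ∑ k, unmatched p i k

theorem totalUnmatched_eq (p : OrderedPair m n) :
    totalUnmatched p = total p.1.2 - total p.1.1 + ∑ k, (p.1.1.1 1 k : ℝ) := by
  rw [totalUnmatched, total_eq, total_eq]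
  simp only [unmatched, Fin.sum_univ_two, Finset.sum_sub_distrib]
  push_cast
  simp
  ring

theorem totalUnmatched_nonneg (p : OrderedPair m n) : 0 ≤ totalUnmatched p :=
  Finset.sum_nonneg fun i _ => Finset.sum_nonneg fun k _ => unmatched_nonneg p i k

theorem sum_layerTwo_le_totalUnmatched (p : OrderedPair m n) :
    ∑ k, (p.1.1.1 1 k : ℝ) ≤ totalUnmatched p := by
  have : (total p.1.1 : ℝ) ≤ total p.1.2 := by exact_mod_cast p.2.2
  rw [totalUnmatched_eq]
  linarith

theorem prec_packingDepart_of_unmatched {p : OrderedPair m n} {x : State m n} {i : Fin 2}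
    {k : Fin K} (hx : ∀ l, x.1 0 l ≤ p.1.1.1 0 l) (ht : total x < total p.1.2)
    (h : unmatched p i k ≠ 0) : Prec x (packingDepart i k p.1.2) := by
  have hpos := (unmatched_nonneg p i k).lt_of_ne' h
  refine prec_packingDepart (fun l => (hx l).trans (p.2.1 l)) ht ?_ ?_
  · have : (0 : ℝ) < p.1.2.1 i k := by
      refine hpos.trans_le (sub_le_self _ ?_)
      split_ifs
      · positivity
      · exact le_rfl
    exact_mod_cast this
  · rintro rfl
    refine (hx k).trans_lt ?_
    simpa [unmatched] using hpos

/-- The coupled generator. Arrivals are common. Each layer-1 customer of the smaller state departs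
together with a layer-1 customer of the same class of the larger state. Each layer-2 customer of the
smaller state departs together with a uniformly chosen unmatched customer of the larger state, and
the unmatched customers depart alone at the remaining rate. If there are no unmatched customers, then
the smaller state has no layer-2 customers either, and the value `0` of the quotients is correct. -/
noncomputable def coupledGenerator (m : Fin K → ℕ) (n : ℕ) (lam : Fin K → ℝ) (c : ℝ) :
    Matrix (OrderedPair m n) (OrderedPair m n) ℝ :=
  moveGenerator (fun k _ => lam k) (fun k p => moveTo p (arrive k p.1.1) (arrive k p.1.2)) +
  moveGenerator (fun (k : Fin K) p => c * p.1.1.1 0 k)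
    (fun k p => moveTo p (minus 0 k p.1.1) (packingDepart 0 k p.1.2)) +
  moveGenerator (fun (j : Fin K × Fin 2 × Fin K) p =>
      c * p.1.1.1 1 j.1 * (unmatched p j.2.1 j.2.2 / totalUnmatched p))
    (fun j p => moveTo p (minus 1 j.1 p.1.1) (packingDepart j.2.1 j.2.2 p.1.2)) +
  moveGenerator (fun (j : Fin 2 × Fin K) p =>
      c * unmatched p j.1 j.2 * (1 - (∑ k, (p.1.1.1 1 k : ℝ)) / totalUnmatched p))
    (fun j p => moveTo p p.1.1 (packingDepart j.1 j.2 p.1.2))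

theorem coupledGenerator_nonneg (hlam : ∀ k, 0 ≤ lam k) (hc : 0 ≤ c) (p q : OrderedPair m n)
    (hpq : p ≠ q) : 0 ≤ coupledGenerator m n lam c p q := by
  refine add_nonneg (add_nonneg (add_nonneg ?_ ?_) ?_) ?_ <;>
    refine moveGenerator_nonneg (fun j r => ?_) p q hpq
  · exact hlam j
  · positivity
  · exact mul_nonneg (by positivity) (div_nonneg (unmatched_nonneg _ _ _)
      (totalUnmatched_nonneg _))
  · exact mul_nonneg (mul_nonneg hc (unmatched_nonneg _ _ _)) (sub_nonneg.2
      (div_le_one_of_le₀ (sum_layerTwo_le_totalUnmatched r) (totalUnmatched_nonneg r)))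

theorem coupledGenerator_mulVec [Fintype (OrderedPair m n)] (F : State m n × State m n → ℝ)
    (p : OrderedPair m n) :
    (coupledGenerator m n lam c).mulVec (fun q => F q.1) p =
      ∑ k, lam k * (F (arrive k p.1.1, arrive k p.1.2) - F p.1) +
      ∑ k, c * p.1.1.1 0 k * (F (minus 0 k p.1.1, packingDepart 0 k p.1.2) - F p.1) +
      ∑ k, ∑ i, ∑ l, c * p.1.1.1 1 k * (unmatched p i l / totalUnmatched p) *
        (F (minus 1 k p.1.1, packingDepart i l p.1.2) - F p.1) +
      ∑ i, ∑ l, c * unmatched p i l * (1 - (∑ k, (p.1.1.1 1 k : ℝ)) / totalUnmatched p) *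
        (F (p.1.1, packingDepart i l p.1.2) - F p.1) := by
  have hdep : ∀ {i : Fin 2} {k : Fin K}, 0 < p.1.1.1 i k →
      total (minus i k p.1.1) < total p.1.2 := by
    intro i k h
    have h1 := total_minus h
    have h2 := p.2.2
    omega
  simp only [coupledGenerator, Matrix.add_mulVec, Pi.add_apply, moveGenerator_mulVec,
    Fintype.sum_prod_type]
  congr 1
  · congr 1
    · congr 1
      · exact Finset.sum_congr rfl fun k _ => mul_sub_moveTo (fun _ => p.2.arrive k) F
      · refine Finset.sum_congr rfl fun k _ => mul_sub_moveTo (fun h => ?_) F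
        have h0 : 0 < p.1.1.1 0 k := by
          refine Nat.pos_of_ne_zero fun h0 => h ?_
          simp [h0]
        have h1 := minus_val_add h0
        have h2 : (minus 0 k p.1.1).1 0 k + 1 = p.1.1.1 0 k := by
          simpa [unitVec_apply] using congrFun (congrFun h1 0) k
        have h3 := p.2.1 k
        refine prec_packingDepart (fun l => (minus_apply_zero_le _ _ _ _).trans (p.2.1 l))
          (hdep h0) (by omega) (fun _ => by omega)
    · refine Finset.sum_congr rfl fun k _ => Finset.sum_congr rfl fun i _ =>
        Finset.sum_congr rfl fun l _ => mul_sub_moveTo (fun h => ?_) F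
      have h0 : 0 < p.1.1.1 1 k := by
        refine Nat.pos_of_ne_zero fun h0 => h ?_
        simp [h0]
      refine prec_packingDepart_of_unmatched (fun l => minus_apply_zero_le _ _ _ _) (hdep h0) ?_
      intro h1
      exact h (by simp [h1])
  · refine Finset.sum_congr rfl fun i _ => Finset.sum_congr rfl fun l _ =>
      mul_sub_moveTo (fun h => ?_) F
    have h1 : unmatched p i l ≠ 0 := fun h1 => h (by simp [h1])
    refine prec_packingDepart_of_unmatched (fun l => le_rfl) (lt_of_le_of_ne p.2.2 ?_) h1
    -- equal totals leave no rate for departures from the larger state alone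
    intro h2
    have h3 := totalUnmatched_eq p
    rw [h2, sub_self, zero_add] at h3
    have h4 : totalUnmatched p ≠ 0 := by
      intro h4
      have h5 := (Finset.sum_eq_zero_iff_of_nonneg (fun i _ => Finset.sum_nonneg fun k _ =>
        unmatched_nonneg p i k)).1 h4 i (Finset.mem_univ i)
      exact h1 ((Finset.sum_eq_zero_iff_of_nonneg (fun k _ =>
        unmatched_nonneg p i k)).1 h5 l (Finset.mem_univ l))
    rw [← h3, div_self h4, sub_self, mul_zero] at h
    exact h rfl

theorem coupledGenerator_mulVec_fst [Fintype (OrderedPair m n)] (hmu : ∀ k, mu k = c)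
    (f : State m n → ℝ) : (coupledGenerator m n lam c).mulVec (fun p => f p.1.1) =
      fun p => (overflowGenerator m n lam mu).mulVec f p.1.1 := by
  funext p
  rw [coupledGenerator_mulVec (fun q => f q.1), overflowGenerator_mulVec hmu]
  simp only [sub_self, mul_zero, Finset.sum_const_zero, add_zero, Fin.sum_univ_two (M := ℝ)
    (f := fun i => ∑ k, c * (p.1.1.1 i k : ℝ) * (f (minus i k p.1.1) - f p.1.1))]
  rw [add_assoc]
  congr 2
  refine Finset.sum_congr rfl fun k _ => ?_
  have h1 : ∑ i, ∑ l, c * p.1.1.1 1 k * (unmatched p i l / totalUnmatched p) *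
      (f (minus 1 k p.1.1) - f p.1.1) =
      c * p.1.1.1 1 k * (totalUnmatched p / totalUnmatched p) *
        (f (minus 1 k p.1.1) - f p.1.1) := by
    simp only [← Finset.sum_mul, ← Finset.mul_sum, ← Finset.sum_div]
    rfl
  rw [h1]
  by_cases h2 : totalUnmatched p = 0
  · have h3 := sum_layerTwo_le_totalUnmatched p
    have h4 : (p.1.1.1 1 k : ℝ) ≤ ∑ k, (p.1.1.1 1 k : ℝ) :=
      Finset.single_le_sum (f := fun k => (p.1.1.1 1 k : ℝ)) (fun _ _ => Nat.cast_nonneg _)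
        (Finset.mem_univ k)
    have h5 : (p.1.1.1 1 k : ℝ) = 0 := le_antisymm (by linarith) (Nat.cast_nonneg _)
    simp [h5]
  · rw [div_self h2, mul_one]

theorem coupledGenerator_mulVec_snd [Fintype (OrderedPair m n)] (hmu : ∀ k, mu k = c)
    (f : State m n → ℝ) : (coupledGenerator m n lam c).mulVec (fun p => f p.1.2) =
      fun p => (packingGenerator m n lam mu).mulVec f p.1.2 := by
  funext p
  rw [coupledGenerator_mulVec (fun q => f q.2), packingGenerator_mulVec hmu]
  simp only [add_assoc]
  congr 1
  have h1 : ∑ k, ∑ i, ∑ l, c * p.1.1.1 1 k * (unmatched p i l / totalUnmatched p) *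
      (f (packingDepart i l p.1.2) - f p.1.2) =
      ∑ i, ∑ l, c * unmatched p i l * ((∑ k, (p.1.1.1 1 k : ℝ)) / totalUnmatched p) *
        (f (packingDepart i l p.1.2) - f p.1.2) := by
    rw [Finset.sum_comm]
    refine Finset.sum_congr rfl fun i _ => ?_
    rw [Finset.sum_comm]
    refine Finset.sum_congr rfl fun l _ => ?_
    rw [← Finset.sum_mul, ← Finset.sum_mul, ← Finset.mul_sum]
    ring
  rw [h1, ← Finset.sum_add_distrib]
  have h2 : ∀ i, ∑ l, c * unmatched p i l * ((∑ k, (p.1.1.1 1 k : ℝ)) / totalUnmatched p) *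
        (f (packingDepart i l p.1.2) - f p.1.2) +
      ∑ l, c * unmatched p i l * (1 - (∑ k, (p.1.1.1 1 k : ℝ)) / totalUnmatched p) *
        (f (packingDepart i l p.1.2) - f p.1.2) =
      ∑ l, c * unmatched p i l * (f (packingDepart i l p.1.2) - f p.1.2) := by
    intro i
    rw [← Finset.sum_add_distrib]
    exact Finset.sum_congr rfl fun l _ => by ring
  simp only [h2, Fin.sum_univ_two]
  rw [← add_assoc, ← Finset.sum_add_distrib]
  congr 1
  · refine Finset.sum_congr rfl fun k _ => ?_
    simp only [unmatched, if_true]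
    ring
  · simp [unmatched]

end Model

theorem measurable_totalPath {K : ℕ} {m : Fin K → ℕ} {n : ℕ} :
    Measurable (totalPath : SkorokhodSpace (State m n) → SkorokhodSpace ℝ) := by
  refine measurable_iff_comap_le.2 ?_
  refine MeasurableSpace.comap_iSup.le.trans (iSup_le fun t => ?_)
  rw [MeasurableSpace.comap_comp, ← measurable_iff_comap_le]
  exact (Measurable.of_discrete (f := fun x : State m n => (total x : ℝ))).comp (measurable_eval t)

end LossSystem

theorem theorem2 {K : ℕ} (m : Fin K → ℕ) (n : ℕ) (lam mu : Fin K → ℝ)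
    (hlam : ∀ k, 0 ≤ lam k) (hmu : ∀ k, 0 ≤ mu k) (hmu_eq : ∀ k l, mu k = mu l)
    {Ω : Type*} [MeasurableSpace Ω] (P : Measure Ω) [IsProbabilityMeasure P]
    (X Xmp : Ω → LossSystem.SkorokhodSpace (LossSystem.State m n))
    (hX : LossSystem.IsMarkovProcess P (LossSystem.overflowGenerator m n lam mu) X)
    (hXmp : LossSystem.IsMarkovProcess P (LossSystem.packingGenerator m n lam mu) Xmp)
    (h0 : ∀ᵐ ω ∂P, LossSystem.Prec (X ω 0) (Xmp ω 0)) :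
    LossSystem.StochLE P (LossSystem.PathRel LossSystem.Prec) X Xmp ∧
      LossSystem.StochLE P (LossSystem.PathRel (fun a b : ℝ => a ≤ b))
        (fun ω => LossSystem.totalPath (X ω)) (fun ω => LossSystem.totalPath (Xmp ω)) := by
  classical
  obtain ⟨c, hc, hmu_c⟩ : ∃ c : ℝ, 0 ≤ c ∧ ∀ k, mu k = c := by
    rcases isEmpty_or_nonempty (Fin K) with h | ⟨⟨k⟩⟩
    · exact ⟨0, le_rfl, fun k => h.elim k⟩
    · exact ⟨mu k, hmu k, fun l => hmu_eq l k⟩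
  have hmain : LossSystem.StochLE P (LossSystem.PathRel LossSystem.Prec) X Xmp :=
    LossSystem.stochLE_of_coupling (LossSystem.coupledGenerator_nonneg hlam hc)
      (LossSystem.coupledGenerator_mulVec_fst hmu_c) (LossSystem.coupledGenerator_mulVec_snd hmu_c)
      hX hXmp h0
  refine ⟨hmain, fun φ hφ ⟨B, hB⟩ hmono => ?_⟩
  refine hmain (fun f => φ (LossSystem.totalPath f)) (hφ.comp LossSystem.measurable_totalPath)
    ⟨B, fun f => hB _⟩ fun f g hfg => hmono _ _ fun t => ?_
  have h : LossSystem.total (f t) ≤ LossSystem.total (g t) := (hfg t).2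
  exact Nat.cast_le.2 h
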